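/- An extensive-form game is a finite game tree in which every non-terminal node belongs to a player or to Chance and the nodes of each player are partitioned into information sets. A deterministic timing of such a game $\Gamma$ is a labelling of its nodes with non-negative real numbers (times) such that the label of any node is at least one higher than the label of its parent; a timing of $\Gamma$ is a discrete probability distribution over deterministic timings. Given a timing and a node $v$ belonging to a player, the player's timing information at $v$ is the random sequence of the times of the nodes belonging to that player on the path from the root to $v$, including $v$. The total variation distance of two discrete random variables is $\delta(X_1,X_2)=\sum_x \max(\Pr(X_1=x)-\Pr(X_2=x),0)$. For $\epsilon>0$, a timing is an $\epsilon$-timing if for any two nodes in the same information set the total variation distance between the timing information at the two nodes is at most $\epsilon$. Let $\exp_2^r(x)$ denote the $r$-th iterate of $x\mapsto 2^x$. **Corollary.** For every integer $r\ge 1$ there exist a finite extensive-form game $\Gamma_r$ of perfect recall with $16r+3$ players, in which every player has at most $3r$ nodes in any history, and a number $\epsilon_r>0$ such that for all $\epsilon$ with $0<\epsilon\le\epsilon_r$, every $\epsilon$-timing of $\Gamma_r$ uses time at least $\exp_2^r(1/\epsilon)$, that is, with positive probability it gives some node of $\Gamma_r$ a time of at least $\exp_2^r(1/\epsilon)$.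 -/

import Mathlib

open scoped ENNReal

noncomputable section

/-- A finite game tree. A node is the finite sequence of actions leading to it from the root,
so the root is `[]` and the children of `h` are the nodes of the form `h ++ [a]`. -/
structure GameTree (A : Type) where
  histories : Set (List A)
  finite_histories : histories.Finite
  nil_mem : [] ∈ histories
  prefix_mem : ∀ (h : List A) (a : A), h ++ [a] ∈ histories → h ∈ histories

namespace GameTree

variable {A : Type} (T : GameTree A)

/-- The nodes of the tree (including the leaves). -/
abbrev Node : Type := {h : List A // h ∈ T.histories}

/-- The action `a` can be taken at the node `v`. -/
def Available (v : T.Node) (a : A) : Prop := v.1 ++ [a] ∈ T.histories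

/-- `v` is a leaf. -/
def IsTerminal (v : T.Node) : Prop := ∀ a, ¬ T.Available v a

/-- `v` is the parent of `w`. -/
def IsParent (v w : T.Node) : Prop := ∃ a, w.1 = v.1 ++ [a]

end GameTree

/-- A finite extensive-form game with set of players `P`. The values of `mover` and `info` are
used only at non-terminal nodes, those of `payoff` only at terminal nodes, and those of `info`
only at nodes of players (not of Chance). -/
structure ExtensiveFormGame (P : Type) where
  Action : Type
  tree : GameTree Action
  /-- the player who moves at a node; `none` stands for Chance -/
  mover : tree.Node → Option P
  /-- names of information sets -/
  Info : Type
  /-- two nodes of one player are in the same information set iff they have the same `info` -/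
  info : tree.Node → Info
  /-- the same actions are available at all nodes of an information set -/
  available_iff : ∀ (p : P) (v w : tree.Node), ¬ tree.IsTerminal v → ¬ tree.IsTerminal w →
    mover v = some p → mover w = some p → info v = info w →
    ∀ a, tree.Available v a ↔ tree.Available w a
  /-- the distribution of the move made at a node of Chance -/
  chance : (v : tree.Node) → ¬ tree.IsTerminal v → mover v = none → PMF Action
  chance_support : ∀ (v : tree.Node) (hv : ¬ tree.IsTerminal v) (hc : mover v = none) (a : Action),
    a ∈ (chance v hv hc).support ↔ tree.Available v a
  payoff : tree.Node → P → ℝ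

namespace ExtensiveFormGame

variable {P : Type} (Γ : ExtensiveFormGame P)

abbrev Node : Type := Γ.tree.Node

/-- The (decision) node `v` belongs to player `p`. -/
def Belongs (p : P) (v : Γ.Node) : Prop := ¬ Γ.tree.IsTerminal v ∧ Γ.mover v = some p

/-- `v` and `w` are in the same information set of player `p`. -/
def SameInfoSet (p : P) (v w : Γ.Node) : Prop :=
  Γ.Belongs p v ∧ Γ.Belongs p w ∧ Γ.info v = Γ.info w

open Classical in
/-- The nodes belonging to player `p` on the path from the root to `v` (including `v` itself if it
belongs to `p`), in the order of the path. -/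
def ownNodes (p : P) (v : Γ.Node) : List Γ.Node :=
  v.1.inits.filterMap fun g =>
    if hg : ∃ hm : g ∈ Γ.tree.histories, Γ.Belongs p ⟨g, hm⟩ then some ⟨g, hg.1⟩ else none

/-- What player `p` has experienced at `v`: her information sets on the path from the root to `v`,
each with the action that she took there (`none` at `v` itself). -/
def experience (p : P) (v : Γ.Node) : List (Γ.Info × Option Γ.Action) :=
  (Γ.ownNodes p v).map fun g => (Γ.info g, v.1[g.1.length]?)

/-- No player ever forgets what she knew or did. -/
def PerfectRecall : Prop :=
  ∀ (p : P) (v w : Γ.Node), Γ.SameInfoSet p v w → Γ.experience p v = Γ.experience p w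

/-- Deterministic timings: labellings of the nodes by non-negative reals such that the label
of a node is at least one higher than that of its parent. -/
def DetTiming : Type :=
  {t : Γ.Node → ℝ // (∀ v, 0 ≤ t v) ∧ ∀ v w, Γ.tree.IsParent v w → t v + 1 ≤ t w}

/-- Timings: discrete distributions over deterministic timings. -/
abbrev Timing : Type := PMF Γ.DetTiming

/-- The timing information of player `p` at the node `v`, under a deterministic timing. -/
def timingInfo (p : P) (v : Γ.Node) (t : Γ.DetTiming) : List ℝ := (Γ.ownNodes p v).map t.1

end ExtensiveFormGame

/-- Total variation distance `∑ₓ max (p x - q x) 0` of two discrete distributions (subtraction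
in `ℝ≥0∞` is truncated at `0`). -/
def tvDist {α : Type} (p q : PMF α) : ℝ≥0∞ := ∑' x, (p x - q x)

namespace ExtensiveFormGame

variable {P : Type} (Γ : ExtensiveFormGame P)

/-- `X` is an `ε`-timing of `Γ`. -/
def IsEpsTiming (ε : ℝ) (X : Γ.Timing) : Prop :=
  ∀ (p : P) (v w : Γ.Node), Γ.SameInfoSet p v w →
    tvDist (X.map (Γ.timingInfo p v)) (X.map (Γ.timingInfo p w)) ≤ ENNReal.ofReal ε

/-- With positive probability some node gets a time of at least `N`. -/
def UsesTimeAtLeast (X : Γ.Timing) (N : ℝ) : Prop :=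
  ∃ t ∈ X.support, ∃ v : Γ.Node, N ≤ t.1 v

end ExtensiveFormGame

/-- The `n`-th iterate of `x ↦ 2 ^ x`: a tower with `n` twos and `x` on top. -/
def expTwoIter (n : ℕ) (x : ℝ) : ℝ := (fun y : ℝ => (2 : ℝ) ^ y)^[n] x

end

/-!
In the game `TimingBound.orderGame` Chance chooses the order in which all players make their `r + 2`
moves each, and a player only knows the number of her earlier moves. So the law of the `r + 2` times
that a player sees is, up to `ε`, independent of the order chosen (`TimeFamily`).

For integer times `x < y` let `splitLevel x y` be the highest binary digit in which `x` and `y`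
differ. It is monotone under inclusion of intervals, and two adjacent intervals never have the same
level. So a triple of times `x < y < z` either ascends (the second gap has the higher level) or
descends. Nested arrangements of two triples show that all triples of all players descend with
nearly the same probability (`TimeFamily.mass_descends_le`), and in a suitable order of the moves
they descend or ascend together up to probability `O(ε)`. If ascent has probability at least one
half, then on that event a time `t` can be replaced by the level of the interval from the player's
first time to `t`, and these levels respect the order of the remaining moves
(`TimeFamily.derive`). If descent is more likely, the same is done after reversing time
(`TimeFamily.mirror`). This is the stepping-down argument known from Ramsey theory: it replaces times
below `2 ^ M` by times below `M` and costs one move per player, two players, and constant factors in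
`ε` and in the total probability (`TimeFamily.exists_log`).

After `r` steps three players with two moves each remain. Comparing the level of an interval with
the levels of two disjoint intervals inside it shows that times below `2 ^ m` need `m` of order at
least `1 / ε` (`TimeFamily.mass_le_of_two_nodes`). Hence an `ε`-timing of the game needs a tower of
`r + 1` twos with a number of order `1 / ε` on top (`exists_mass_le`); the additional exponential
absorbs the constant when `ε` is small (`exists_exponent`).
-/

open MeasureTheory

namespace TimingBound

/-! ### The highest digit in which two numbers differ -/

/-- The highest binary digit in which `x` and `y` differ, for `x < y`; it is `0` for `y ≤ x`. -/
def splitLevel (x y : ℕ) : ℕ := Nat.findGreatest (fun m => x / 2 ^ m < y / 2 ^ m) y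

lemma le_splitLevel_iff {x y m : ℕ} (hm : m ≠ 0) :
    m ≤ splitLevel x y ↔ x / 2 ^ m < y / 2 ^ m := by
  constructor
  · intro h
    have hg : splitLevel x y ≠ 0 := by omega
    have hP : x / 2 ^ splitLevel x y < y / 2 ^ splitLevel x y :=
      Nat.findGreatest_of_ne_zero (P := fun m => x / 2 ^ m < y / 2 ^ m) rfl hg
    by_contra hle
    push Not at hle
    obtain ⟨d, hd⟩ := Nat.exists_eq_add_of_le h
    rw [hd, pow_add, ← Nat.div_div_eq_div_mul, ← Nat.div_div_eq_div_mul] at hP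
    exact absurd (Nat.div_le_div_right hle) (not_le.mpr hP)
  · intro h
    refine Nat.le_findGreatest ?_ h
    have h1 : 2 ^ m ≤ y := by
      by_contra hlt
      rw [Nat.div_eq_of_lt (not_le.mp hlt)] at h
      exact Nat.not_lt_zero _ h
    exact (Nat.lt_two_pow_self.le).trans h1

lemma div_lt_div_of_le_splitLevel {x y m : ℕ} (hxy : x < y) (h : m ≤ splitLevel x y) :
    x / 2 ^ m < y / 2 ^ m := by
  rcases Nat.eq_zero_or_pos m with rfl | hm
  · simpa using hxy
  · exact (le_splitLevel_iff hm.ne').1 h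

lemma splitLevel_mono {x y x' y' : ℕ} (hx : x' ≤ x) (hy : y ≤ y') :
    splitLevel x y ≤ splitLevel x' y' := by
  rcases Nat.eq_zero_or_pos (splitLevel x y) with h | h
  · omega
  · rw [le_splitLevel_iff h.ne']
    exact (Nat.div_le_div_right hx).trans_lt
      (((le_splitLevel_iff h.ne').1 le_rfl).trans_le (Nat.div_le_div_right hy))

lemma splitLevel_le_max (x y z : ℕ) :
    splitLevel x z ≤ max (splitLevel x y) (splitLevel y z) := by
  rcases Nat.eq_zero_or_pos (splitLevel x z) with h | h
  · omega
  · have h1 := (le_splitLevel_iff h.ne').1 (le_refl (splitLevel x z))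
    rw [le_max_iff, le_splitLevel_iff h.ne', le_splitLevel_iff h.ne']
    omega

/-- Two disjoint intervals splitting at the same binary digit are separated by a change of a
higher digit. -/
lemma lt_splitLevel_of_eq {x y y' z : ℕ} (hxy : x < y) (hyy : y ≤ y') (hyz : y' < z)
    (h : splitLevel x y = splitLevel y' z) : splitLevel x y < splitLevel x z := by
  set l := splitLevel x y with hl
  have h1 : x / 2 ^ l < y / 2 ^ l := div_lt_div_of_le_splitLevel hxy hl.le
  have h2 : y' / 2 ^ l < z / 2 ^ l := div_lt_div_of_le_splitLevel hyz h.le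
  have h3 : y / 2 ^ l ≤ y' / 2 ^ l := Nat.div_le_div_right hyy
  rw [Nat.lt_iff_add_one_le, le_splitLevel_iff (by omega), pow_succ,
    ← Nat.div_div_eq_div_mul, ← Nat.div_div_eq_div_mul]
  omega

lemma splitLevel_ne {x y z : ℕ} (hxy : x < y) (hyz : y < z) :
    splitLevel x y ≠ splitLevel y z := by
  intro h
  have h1 := lt_splitLevel_of_eq hxy le_rfl hyz h
  have h2 := splitLevel_le_max x y z
  omega

lemma splitLevel_lt {x y M : ℕ} (hxy : x < y) (hy : y < 2 ^ M) : splitLevel x y < M := by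
  by_contra h
  have := div_lt_div_of_le_splitLevel hxy (not_lt.mp h)
  rw [Nat.div_eq_of_lt hy] at this
  exact Nat.not_lt_zero _ this

lemma mirror_div {x M m : ℕ} (hx : x < 2 ^ M) (hm : m ≤ M) :
    (2 ^ M - 1 - x) / 2 ^ m = 2 ^ (M - m) - 1 - x / 2 ^ m := by
  have hpow : 2 ^ M = 2 ^ (M - m) * 2 ^ m := by rw [← pow_add]; congr 1; omega
  have hpos : 0 < 2 ^ m := by positivity
  have hq : x / 2 ^ m < 2 ^ (M - m) := by
    rw [Nat.div_lt_iff_lt_mul hpos]; omega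
  have hdm := Nat.div_add_mod' x (2 ^ m)
  have hr := Nat.mod_lt x hpos
  obtain ⟨d, hd⟩ := Nat.exists_eq_add_of_lt hq
  generalize x / 2 ^ m = q at *
  generalize x % 2 ^ m = s at *
  have e1 : 2 ^ (M - m) - 1 - q = d := by omega
  have e2 : 2 ^ M - 1 - x = d * 2 ^ m + (2 ^ m - 1 - s) := by
    rw [hpow, hd, ← hdm]
    have : (q + d + 1) * 2 ^ m = q * 2 ^ m + d * 2 ^ m + 2 ^ m := by ring
    omega
  rw [e1, e2, add_comm, Nat.add_mul_div_right _ _ hpos, Nat.div_eq_of_lt (by omega), zero_add]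

/-- Complementing all binary digits does not change the place where two numbers differ. -/
lemma splitLevel_mirror {x y M : ℕ} (hxy : x < y) (hy : y < 2 ^ M) :
    splitLevel (2 ^ M - 1 - y) (2 ^ M - 1 - x) = splitLevel x y := by
  have key : ∀ m ≤ M, ((2 ^ M - 1 - y) / 2 ^ m < (2 ^ M - 1 - x) / 2 ^ m ↔
      x / 2 ^ m < y / 2 ^ m) := by
    intro m hm
    rw [mirror_div hy hm, mirror_div (hxy.trans hy) hm]
    have : y / 2 ^ m < 2 ^ (M - m) := by
      rw [Nat.div_lt_iff_lt_mul (by positivity), ← pow_add]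
      rwa [Nat.sub_add_cancel hm]
    omega
  have h1 : splitLevel x y < M := splitLevel_lt hxy hy
  have h2 : splitLevel (2 ^ M - 1 - y) (2 ^ M - 1 - x) < M :=
    splitLevel_lt (by omega) (by omega)
  apply le_antisymm
  · rcases Nat.eq_zero_or_pos (splitLevel (2 ^ M - 1 - y) (2 ^ M - 1 - x)) with h | h
    · omega
    · rw [le_splitLevel_iff h.ne', ← key _ h2.le, ← le_splitLevel_iff h.ne']
  · rcases Nat.eq_zero_or_pos (splitLevel x y) with h | h
    · omega
    · rw [le_splitLevel_iff h.ne', key _ h1.le, ← le_splitLevel_iff h.ne']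

/-! ### Families of random times indexed by schedules -/

/-- The gap between the second and third of three times dominates the gap between the first and
second: seen on the logarithmic scale of `splitLevel`, the triple runs away from its start. -/
def Ascends {k : ℕ} (t : Fin k → ℕ) (a b d : Fin k) : Prop :=
  splitLevel (t a) (t b) < splitLevel (t b) (t d)

/-- The first gap dominates the second: the triple converges to its end. -/
def Descends {k : ℕ} (t : Fin k → ℕ) (a b d : Fin k) : Prop :=
  splitLevel (t b) (t d) < splitLevel (t a) (t b)

lemma ascends_or_descends {k : ℕ} {t : Fin k → ℕ} (ht : StrictMono t) {a b d : Fin k}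
    (hab : a < b) (hbd : b < d) : Ascends t a b d ∨ Descends t a b d :=
  lt_or_gt_of_ne (splitLevel_ne (ht hab) (ht hbd))

lemma Ascends.not_descends {k : ℕ} {t : Fin k → ℕ} {a b d : Fin k} (h : Ascends t a b d) :
    ¬ Descends t a b d := lt_asymm h

/-- If the first interval of `t` contains that of `s`, and the second one is contained in that of
`s`, then `t` descends when `s` does. -/
lemma Descends.of_nested {k : ℕ} {s t : Fin k → ℕ} {a b d a' b' d' : Fin k}
    (h : Descends s a b d) (ha : t a' ≤ s a) (hb : s b ≤ t b') (hd : t d' ≤ s d) :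
    Descends t a' b' d' :=
  (splitLevel_mono hb hd).trans_lt (h.trans_le (splitLevel_mono ha hb))

/-- A schedule places, for each letter (player) of `A`, an increasing sequence of `k` nodes on an
integer line. Nodes of different letters may share a place; no order is then required of them. -/
abbrev Schedule (A : Type) (k : ℕ) : Type := {w : A → Fin k → ℤ // ∀ p, StrictMono (w p)}

/-- For each schedule, random natural times of its nodes that respect the schedule (weakly between
different letters, strictly along each letter) and lie below `N`, such that the joint law of the
`k` times of any one letter is the same for all schedules up to `ε`. All this is asked only on an
event `good w` of measure at least `c`; the laws compared are those of the restrictions of `μ` to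
these events. -/
structure TimeFamily {Ω : Type} [MeasurableSpace Ω] (μ : Measure Ω) (A : Type) (k N : ℕ)
    (c ε : ℝ) where
  good : Schedule A k → Set Ω
  time : Schedule A k → Ω → A → Fin k → ℕ
  ordered : ∀ {w ω p q i j}, ω ∈ good w → w.1 p i < w.1 q j → time w ω p i ≤ time w ω q j
  strictMono : ∀ {w ω}, ω ∈ good w → ∀ p, StrictMono (time w ω p)
  time_lt : ∀ {w ω}, ω ∈ good w → ∀ p i, time w ω p i < N
  close : ∀ (w v : Schedule A k) (p : A) (S : Set (Fin k → ℕ)),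
    μ.real {ω ∈ good w | time w ω p ∈ S} ≤ μ.real {ω ∈ good v | time v ω p ∈ S} + ε
  mass : ∀ w, c ≤ μ.real (good w)

namespace TimeFamily

variable {Ω : Type} [MeasurableSpace Ω] {μ : Measure Ω} {A : Type} {k N : ℕ} {c ε : ℝ}

/-- Letters can be left out: they only have to be put somewhere into each schedule. -/
noncomputable def comap {B : Type} (F : TimeFamily μ B k N c ε) (f : A → B) (hf : f.Injective) :
    TimeFamily μ A k N c ε := by
  let ext (w : Schedule A k) : Schedule B k :=
    ⟨Function.extend f w.1 (fun _ i => (i : ℤ)), fun b => by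
      by_cases hb : ∃ a, f a = b
      · obtain ⟨a, rfl⟩ := hb
        rw [hf.extend_apply]
        exact w.2 a
      · rw [Function.extend_apply' _ _ _ hb]
        intro i j hij
        exact Int.ofNat_lt.2 hij⟩
  exact
  { good := fun w => F.good (ext w)
    time := fun w ω p => F.time (ext w) ω (f p)
    ordered := fun {w ω p q i j} hω h => F.ordered hω (by
      simpa only [ext, hf.extend_apply] using h)
    strictMono := fun hω p => F.strictMono hω (f p)
    time_lt := fun hω p i => F.time_lt hω (f p) i
    close := fun w v p S => F.close (ext w) (ext v) (f p) S
    mass := fun w => F.mass (ext w) }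

/-- Reversal of the direction of time. -/
def mirror {M : ℕ} (F : TimeFamily μ A k (2 ^ M) c ε) : TimeFamily μ A k (2 ^ M) c ε := by
  let rev (w : Schedule A k) : Schedule A k :=
    ⟨fun p i => - w.1 p i.rev, fun p i j hij => by
      have := w.2 p (Fin.rev_lt_rev.2 hij)
      simpa using this⟩
  exact
  { good := fun w => F.good (rev w)
    time := fun w ω p i => 2 ^ M - 1 - F.time (rev w) ω p i.rev
    ordered := fun {w ω p q i j} hω h => by
      have := F.ordered (p := q) (q := p) (i := j.rev) (j := i.rev) hω (by simpa [rev] using h)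
      omega
    strictMono := fun {w ω} hω p i j hij => by
      have h1 := F.strictMono hω p (Fin.rev_lt_rev.2 hij)
      have h2 := F.time_lt hω p i.rev
      show 2 ^ M - 1 - _ < 2 ^ M - 1 - _
      omega
    time_lt := fun {w ω} hω p i => by
      have := F.time_lt hω p i
      show 2 ^ M - 1 - _ < _
      omega
    close := fun w v p S =>
      F.close (rev w) (rev v) p {t | (fun i : Fin k => 2 ^ M - 1 - t i.rev) ∈ S}
    mass := fun w => F.mass (rev w) }

/-- All triples of all letters descend with nearly the same probability. The proof compares two
letters in a schedule where `q a' < p a` and `p b < q b'` and `q d' < p d`, in which a descending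
triple of `p` forces one of `q`. -/
lemma mass_descends_le (F : TimeFamily μ A k N c ε) [IsFiniteMeasure μ] {p q : A} (hpq : p ≠ q)
    {a b d a' b' d' : Fin k} (hbd : b < d) (hab' : a' < b') (w v : Schedule A k) :
    μ.real {ω ∈ F.good w | Descends (F.time w ω p) a b d} ≤
      μ.real {ω ∈ F.good v | Descends (F.time v ω q) a' b' d'} + 2 * ε := by
  classical
  let u : Schedule A k := ⟨fun x i =>
    if x = q then (if i ≤ a' then (i : ℤ) else i + 2 * k)
    else (if i ≤ b then (i : ℤ) + k else i + 4 * k), fun x i j hij => by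
      have hij' : (i : ℕ) < j := hij
      simp only [Fin.le_def]
      split_ifs <;> omega⟩
  have huq : ∀ i, u.1 q i = if i ≤ a' then (i : ℤ) else i + 2 * k := fun i => if_pos rfl
  have hup : ∀ i, u.1 p i = if i ≤ b then (i : ℤ) + k else i + 4 * k := fun i => if_neg hpq
  have h1 := F.close w u p {t | Descends t a b d}
  have h2 := F.close u v q {t | Descends t a' b' d'}
  have h3 : μ.real {ω ∈ F.good u | F.time u ω p ∈ {t | Descends t a b d}} ≤
      μ.real {ω ∈ F.good u | F.time u ω q ∈ {t | Descends t a' b' d'}} := by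
    refine measureReal_mono ?_
    rintro ω ⟨hω, hD⟩
    refine ⟨hω, Descends.of_nested hD (F.ordered hω ?_) (F.ordered hω ?_) (F.ordered hω ?_)⟩
    · rw [huq, hup, if_pos le_rfl]
      split_ifs <;> omega
    · rw [huq, hup, if_pos le_rfl, if_neg (not_le.2 hab')]
      omega
    · rw [huq, hup, if_neg (not_le.2 hbd)]
      split_ifs <;> omega
  simp only [Set.mem_ofPred_eq] at h1 h2 h3
  linarith

end TimeFamily

/-- A schedule `w` of `A` is extended by first nodes of its letters in front, and by two helper
letters `none` and `some none`. In front of `w`, the order is: first node of `some none`, first nodes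
of `A`, two nodes of `none`, two nodes of `some none`; the other nodes of the helpers follow `w`. -/
lemma exists_lift (A : Type) [Fintype A] {n : ℕ} (w : Schedule A (n + 2)) :
    ∃ v : Schedule (Option (Option A)) (n + 3),
      (∀ p : A, v.1 (some none) 0 < v.1 (some (some p)) 0) ∧
      (∀ p : A, v.1 (some (some p)) 0 < v.1 none 0) ∧
      v.1 (some none) 0 < v.1 none 0 ∧
      v.1 none 1 < v.1 (some none) 1 ∧
      (∀ (p : A) i, v.1 (some none) 2 < v.1 (some (some p)) (Fin.succ i)) ∧
      (∀ (p : A) i, v.1 (some (some p)) (Fin.succ i) < v.1 none 2) ∧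
      v.1 (some none) 2 < v.1 none 2 ∧
      (∀ p q i j, w.1 p i < w.1 q j →
        v.1 (some (some p)) (Fin.succ i) < v.1 (some (some q)) (Fin.succ j)) := by
  obtain ⟨B, hB⟩ : ∃ B : ℤ, ∀ p i, |w.1 p i| ≤ B := by
    obtain ⟨B, hB⟩ := (Set.finite_range fun x : A × Fin (n + 2) => |w.1 x.1 x.2|).bddAbove
    exact ⟨B, fun p i => hB ⟨(p, i), rfl⟩⟩
  let b : ℤ := max B 0
  have hb0 : 0 ≤ b := le_max_right _ _
  have hb : ∀ p i, -b ≤ w.1 p i ∧ w.1 p i ≤ b := fun p i =>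
    abs_le.1 ((hB p i).trans (le_max_left _ _))
  let v : Option (Option A) → Fin (n + 3) → ℤ := fun x => match x with
    | none => fun i => if (i : ℕ) < 2 then i - b - 5 else i + b
    | some none => fun i => if (i : ℕ) = 0 then -b - 7 else if (i : ℕ) < 3 then i - b - 4 else i + b
    | some (some p) => Fin.cons (-b - 6) (w.1 p)
  have hv : ∀ x, StrictMono (v x) := by
    intro x i j hij
    have hij' : (i : ℕ) < j := hij
    match x with
    | none => simp only [v]; split_ifs <;> omega
    | some none => simp only [v]; split_ifs <;> omega
    | some (some p) =>
      simp only [v]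
      revert hij
      refine Fin.cases ?_ (fun i' => ?_) i <;> refine Fin.cases ?_ (fun j' => ?_) j
      · simp
      · intro _
        have := hb p j'
        simp only [Fin.cons_zero, Fin.cons_succ]
        omega
      · simp
      · intro h
        simpa using w.2 p (Fin.succ_lt_succ_iff.1 h)
  have e2 : ((2 : Fin (n + 3)) : ℕ) = 2 := rfl
  have e1 : ((1 : Fin (n + 3)) : ℕ) = 1 := rfl
  have e0 : ((0 : Fin (n + 3)) : ℕ) = 0 := rfl
  refine ⟨⟨v, hv⟩, fun p => ?_, fun p => ?_, ?_, ?_, fun p i => ?_, fun p i => ?_, ?_,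
    fun p q i j h => ?_⟩
  · simp [v]
  · simp [v]
  · simp [v]
  · simp [v]
  · have := hb p i
    simp only [v, e2, Fin.cons_succ]
    norm_num
    omega
  · have := hb p i
    simp only [v, e2, Fin.cons_succ]
    norm_num
    omega
  · simp only [v, e2]
    norm_num
    omega
  · simpa [v] using h

/-! ### One logarithm per node -/

namespace TimeFamily

variable {Ω : Type} [MeasurableSpace Ω] [DiscreteMeasurableSpace Ω] {μ : Measure Ω}
  [IsFiniteMeasure μ] {A : Type} {k N : ℕ} {c ε : ℝ}

/-- If, in the schedule `w`, a descending triple of `q` forces one of `p`, then the converse holds up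
to an event of measure `2 * ε`, since both triples descend with nearly the same probability. -/
lemma mass_descends_diff_le (F : TimeFamily μ A k N c ε) {p q : A} (hpq : p ≠ q)
    {a b d a' b' d' : Fin k} (hab' : a' < b') (hbd : b < d) (w : Schedule A k)
    (himp : ∀ ω ∈ F.good w, Descends (F.time w ω q) a' b' d' → Descends (F.time w ω p) a b d) :
    μ.real {ω ∈ F.good w | Descends (F.time w ω p) a b d ∧ Ascends (F.time w ω q) a' b' d'} ≤
      2 * ε := by
  have h1 := F.mass_descends_le hpq (a := a) (d' := d') hbd hab' w w
  have h2 : {ω ∈ F.good w | Descends (F.time w ω q) a' b' d'} ⊆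
      {ω ∈ F.good w | Descends (F.time w ω p) a b d} := fun ω hω => ⟨hω.1, himp ω hω.1 hω.2⟩
  have h3 := measureReal_sdiff (μ := μ) h2 (MeasurableSet.of_discrete)
  have h4 : μ.real {ω ∈ F.good w | Descends (F.time w ω p) a b d ∧
      Ascends (F.time w ω q) a' b' d'} ≤
      μ.real ({ω ∈ F.good w | Descends (F.time w ω p) a b d} \
        {ω ∈ F.good w | Descends (F.time w ω q) a' b' d'}) :=
    measureReal_mono fun ω hω => ⟨⟨hω.1, hω.2.1⟩, fun h => hω.2.2.not_descends h.2⟩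
  linarith

/-- Suppose that the first three times of the helper letter `none` ascend with probability at least
`c₁`. Then the levels `splitLevel (t 0) (t (i + 1))` of the times `t` of the other letters form a
family with one node fewer per letter, on the event that all relevant triples ascend. In the
schedule of `exists_lift`, a descending triple of `none` forces all these triples to descend; hence
they ascend together with it, up to a measure of `2 * ε` for each of them. The ascent of `some none` makes all gaps
between first nodes negligible, so that all levels are measured from a common starting point. -/
theorem derive [Fintype A] {n M : ℕ} (hε : 0 ≤ ε)
    (F : TimeFamily μ (Option (Option A)) (n + 3) (2 ^ M) c ε) (c₁ : ℝ)
    (hc₁ : ∀ v, c₁ ≤ μ.real {ω ∈ F.good v | Ascends (F.time v ω none) 0 1 2}) :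
    Nonempty (TimeFamily μ A (n + 2) M
      (c₁ - 2 * (Fintype.card A * (n + 2) ^ 2 + 1) * ε)
      (ε + 2 * (Fintype.card A * (n + 2) ^ 2 + 1) * ε)) := by
  classical
  have h01 : (0 : Fin (n + 3)) < 1 := by simp
  have h12 : (1 : Fin (n + 3)) < 2 := Nat.lt_succ_self 1
  have h0s : ∀ i : Fin (n + 2), (0 : Fin (n + 3)) < i.succ := Fin.succ_pos
  choose v hzp hpy hzy hyz hzw hwy hzy2 hww using exists_lift A (n := n)
  let T (w : Schedule A (n + 2)) (ω : Ω) : Option (Option A) → Fin (n + 3) → ℕ := F.time (v w) ω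
  -- all triples starting at the first node of `p` ascend
  let Asc (t : Fin (n + 3) → ℕ) : Prop := ∀ i j : Fin (n + 2), i < j → Ascends t 0 i.succ j.succ
  let good (w : Schedule A (n + 2)) : Set Ω := {ω ∈ F.good (v w) |
    Ascends (T w ω none) 0 1 2 ∧ Ascends (T w ω (some none)) 0 1 2 ∧
      ∀ p : A, Asc (T w ω (some (some p)))}
  have himp : ∀ w, ∀ ω ∈ F.good (v w), Descends (T w ω none) 0 1 2 → ∀ (p : A) i j,
      Descends (T w ω (some (some p))) 0 (Fin.succ i) (Fin.succ j) := by
    intro w ω hω hD p i j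
    refine hD.of_nested (F.ordered hω (hpy w p)) ?_ (F.ordered hω (hwy w p j))
    exact F.ordered hω ((hyz w).trans (((v w).2 _ h12).trans (hzw w p i)))
  have himpz : ∀ w, ∀ ω ∈ F.good (v w), Descends (T w ω none) 0 1 2 →
      Descends (T w ω (some none)) 0 1 2 := by
    intro w ω hω hD
    exact hD.of_nested (F.ordered hω (hzy w)) (F.ordered hω (hyz w)) (F.ordered hω (hzy2 w))
  have hbad : ∀ w, μ.real ({ω ∈ F.good (v w) | Ascends (T w ω none) 0 1 2} \ good w) ≤
      2 * (Fintype.card A * (n + 2) ^ 2 + 1) * ε := by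
    intro w
    -- `Z` and `Y x` are the events that a triple descends although that of `none` ascends
    let Z : Set Ω := {ω ∈ F.good (v w) | Descends (T w ω (some none)) 0 1 2 ∧
      Ascends (T w ω none) 0 1 2}
    let Y (x : A × Fin (n + 2) × Fin (n + 2)) : Set Ω := {ω | x.2.1 < x.2.2 ∧ ω ∈ F.good (v w) ∧
      Descends (T w ω (some (some x.1))) 0 x.2.1.succ x.2.2.succ ∧
      Ascends (T w ω none) 0 1 2}
    have hsub : {ω ∈ F.good (v w) | Ascends (T w ω none) 0 1 2} \ good w ⊆ Z ∪ ⋃ x, Y x := by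
      rintro ω ⟨⟨hω, hA⟩, hn⟩
      by_contra hcon
      simp only [Set.mem_union, Set.mem_iUnion, not_or, not_exists] at hcon
      refine hn ⟨hω, hA, ?_, fun p i j hij => ?_⟩
      · exact (ascends_or_descends (F.strictMono hω _) h01 h12).resolve_right
          fun h => hcon.1 ⟨hω, h, hA⟩
      · exact (ascends_or_descends (F.strictMono hω _) (h0s i)
          (Fin.succ_lt_succ_iff.2 hij)).resolve_right
          fun h => hcon.2 (p, i, j) ⟨hij, hω, h, hA⟩
    have hZ : μ.real Z ≤ 2 * ε :=
      F.mass_descends_diff_le (by simp) h01 h12 (v w) (himpz w)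
    have hY : ∀ x, μ.real (Y x) ≤ 2 * ε := by
      rintro ⟨p, i, j⟩
      by_cases hij : i < j
      · refine (measureReal_mono fun ω hω => hω.2).trans
          (F.mass_descends_diff_le (by simp) h01 (Fin.succ_lt_succ_iff.2 hij) (v w)
            fun ω hω hD => himp w ω hω hD p i j)
      · have : Y (p, i, j) = ∅ := Set.eq_empty_of_forall_notMem fun ω hω => hij hω.1
        rw [this, measureReal_empty]
        linarith
    calc _ ≤ μ.real (Z ∪ ⋃ x, Y x) := measureReal_mono hsub
      _ ≤ μ.real Z + μ.real (⋃ x, Y x) := measureReal_union_le _ _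
      _ ≤ 2 * ε + ∑ x : A × Fin (n + 2) × Fin (n + 2), 2 * ε :=
        add_le_add hZ ((measureReal_iUnion_fintype_le _).trans
          (Finset.sum_le_sum fun x _ => hY x))
      _ = _ := by
        simp only [Finset.sum_const, Finset.card_univ, Fintype.card_prod, Fintype.card_fin,
          nsmul_eq_mul]
        push_cast
        ring
  refine ⟨{
    good := good
    time := fun w ω p i => splitLevel (T w ω (some (some p)) 0) (T w ω (some (some p)) i.succ)
    ordered := ?_
    strictMono := ?_
    time_lt := ?_
    close := ?_
    mass := ?_ }⟩
  · rintro w ω p q i j ⟨hω, -, hz, -⟩ h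
    have h1 : T w ω (some (some p)) i.succ ≤ T w ω (some (some q)) j.succ :=
      F.ordered hω (hww w p q i j h)
    have h2 : T w ω (some none) 0 ≤ T w ω (some (some p)) 0 := F.ordered hω (hzp w p)
    have h3 : T w ω (some (some q)) 0 ≤ T w ω (some none) 1 :=
      F.ordered hω ((hpy w q).trans (((v w).2 _ h01).trans (hyz w)))
    have h4 : T w ω (some none) 2 ≤ T w ω (some (some q)) j.succ := F.ordered hω (hzw w q j)
    have h5 := splitLevel_mono h2 h1
    have h6 := splitLevel_le_max (T w ω (some none) 0) (T w ω (some (some q)) 0)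
      (T w ω (some (some q)) j.succ)
    have h7 := splitLevel_mono (le_refl (T w ω (some none) 0)) h3
    have h8 := splitLevel_mono h3 h4
    have h9 : splitLevel (T w ω (some none) 0) (T w ω (some none) 1) <
      splitLevel (T w ω (some none) 1) (T w ω (some none) 2) := hz
    omega
  · rintro w ω ⟨hω, -, -, hp⟩ p i j hij
    exact (hp p i j hij).trans_le
      (splitLevel_mono (F.strictMono hω _ (h0s i)).le le_rfl)
  · rintro w ω ⟨hω, -⟩ p i
    exact splitLevel_lt (F.strictMono hω _ (h0s i)) (F.time_lt hω _ _)
  · intro w u p S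
    let S' : Set (Fin (n + 3) → ℕ) :=
      {t | Asc t ∧ (fun i : Fin (n + 2) => splitLevel (t 0) (t i.succ)) ∈ S}
    have h1 := F.close (v w) (v u) (some (some p)) S'
    have h2 : μ.real {ω ∈ good w | (fun i : Fin (n + 2) => splitLevel (T w ω (some (some p)) 0)
        (T w ω (some (some p)) i.succ)) ∈ S} ≤
        μ.real {ω ∈ F.good (v w) | F.time (v w) ω (some (some p)) ∈ S'} :=
      measureReal_mono fun ω hω => ⟨hω.1.1, hω.1.2.2.2 p, hω.2⟩
    have h3 : {ω ∈ F.good (v u) | F.time (v u) ω (some (some p)) ∈ S'} ⊆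
        {ω ∈ good u | (fun i : Fin (n + 2) => splitLevel (T u ω (some (some p)) 0)
          (T u ω (some (some p)) i.succ)) ∈ S} ∪
        ({ω ∈ F.good (v u) | Ascends (T u ω none) 0 1 2} \ good u) := by
      rintro ω ⟨hω, hA, hS⟩
      by_cases hg : ω ∈ good u
      · exact Or.inl ⟨hg, hS⟩
      · refine Or.inr ⟨⟨hω, ?_⟩, hg⟩
        -- a descending helper would make `p` descend as well
        refine (ascends_or_descends (F.strictMono hω _) h01 h12).resolve_right fun h => ?_
        have h01' : (0 : Fin (n + 2)) < 1 := by simp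
        exact (hA 0 1 h01').not_descends (himp u ω hω h p 0 1)
    have h4 := (measureReal_mono (μ := μ) h3).trans (measureReal_union_le _ _)
    have h5 := hbad u
    linarith
  · intro w
    have h1 := hc₁ (v w)
    have h2 : {ω ∈ F.good (v w) | Ascends (T w ω none) 0 1 2} ⊆
        good w ∪ ({ω ∈ F.good (v w) | Ascends (T w ω none) 0 1 2} \ good w) := by
      intro ω hω
      by_cases hg : ω ∈ good w
      · exact Or.inl hg
      · exact Or.inr ⟨hω, hg⟩
    have h3 := (measureReal_mono (μ := μ) h2).trans (measureReal_union_le _ _)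
    have h4 := hbad w
    linarith

/-- From times below `2 ^ M` to times below `M`, at the cost of one node per letter, two letters,
half of the mass and a constant factor in `ε`: either the helper ascends with probability at least
`c / 2`, or it does so, up to `O(ε)`, after time has been reversed. -/
theorem exists_log [Fintype A] {n M : ℕ} (hε : 0 ≤ ε)
    (F : TimeFamily μ (Option (Option A)) (n + 3) (2 ^ M) c ε) :
    Nonempty (TimeFamily μ A (n + 2) M
      (c / 2 - 4 * ε - 2 * (Fintype.card A * (n + 2) ^ 2 + 1) * ε)
      (ε + 2 * (Fintype.card A * (n + 2) ^ 2 + 1) * ε)) := by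
  have h01 : (0 : Fin (n + 3)) < 1 := by simp
  have h12 : (1 : Fin (n + 3)) < 2 := Nat.lt_succ_self 1
  let w₀ : Schedule (Option (Option A)) (n + 3) := ⟨fun _ i => i, fun _ i j h => Int.ofNat_lt.2 h⟩
  by_cases h : c / 2 ≤ μ.real {ω ∈ F.good w₀ | Ascends (F.time w₀ ω none) 0 1 2}
  · refine F.derive hε _ fun v => ?_
    have h1 := F.close w₀ v none {t | Ascends t 0 1 2}
    simp only [Set.mem_ofPred_eq] at h1
    linarith
  · refine F.mirror.derive hε _ fun v => ?_
    have h1 : F.good w₀ ⊆ {ω ∈ F.good w₀ | Ascends (F.time w₀ ω none) 0 1 2} ∪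
        {ω ∈ F.good w₀ | Descends (F.time w₀ ω none) 0 1 2} := by
      intro ω hω
      exact (ascends_or_descends (F.strictMono hω none) h01 h12).imp (⟨hω, ·⟩) (⟨hω, ·⟩)
    have h2 := (measureReal_mono (μ := μ) h1).trans (measureReal_union_le _ _)
    have h3 := F.mass w₀
    let v' : Schedule (Option (Option A)) (n + 3) := ⟨fun p i => - v.1 p i.rev, fun p i j hij => by
      have := v.2 p (Fin.rev_lt_rev.2 hij)
      simpa using this⟩
    -- two triples of `none` are compared by way of the other helper
    have h4 := F.mass_descends_le (p := none) (q := some none) (by simp) (a := 0) h12 h01 w₀ w₀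
      (d' := 2)
    have h5 := F.mass_descends_le (p := some none) (q := none) (by simp) (a := 0) h12
      (Fin.rev_lt_rev.2 h12) w₀ v' (d' := Fin.rev 0)
    have h6 : μ.real {ω ∈ F.good v' |
          Descends (F.time v' ω none) (Fin.rev 2) (Fin.rev 1) (Fin.rev 0)} ≤
        μ.real {ω ∈ F.mirror.good v | Ascends (F.mirror.time v ω none) 0 1 2} := by
      refine measureReal_mono ?_
      rintro ω ⟨hω, hD⟩
      refine ⟨hω, ?_⟩
      have hs := F.strictMono hω none
      -- reversing time exchanges the two gaps of a triple and keeps their levels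
      have e1 := splitLevel_mirror (hs (Fin.rev_lt_rev.2 h01)) (F.time_lt hω none (Fin.rev 0))
      have e2 := splitLevel_mirror (hs (Fin.rev_lt_rev.2 h12)) (F.time_lt hω none (Fin.rev 1))
      have hD' : splitLevel _ _ < splitLevel _ _ := hD
      rw [← e1, ← e2] at hD'
      exact hD'
    linarith

/-- With two nodes per letter, compare the levels of the two times of each letter. In the first
schedule below the interval of letter `2` contains the disjoint intervals of `0` and `1`, so its level
exceeds one of theirs; in the second one its interval lies inside both of theirs, so that its level
is at most theirs. The levels being equally distributed up to `ε`, summing over all `m` levels gives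
the bound. -/
theorem mass_le_of_two_nodes {m : ℕ} (F : TimeFamily μ (Fin 3) 2 (2 ^ m) c ε) :
    c ≤ 4 * ε * m := by
  -- the orders `2 0 0 1 1 2` and `0 1 2 2 1 0`
  have mk : ∀ a b : Fin 3 → ℤ, (∀ p, a p < b p) → ∀ p, StrictMono (![a p, b p] : Fin 2 → ℤ) := by
    intro a b h p
    refine Fin.strictMono_iff_lt_succ.2 fun i => ?_
    fin_cases i
    simpa using h p
  let w : Schedule (Fin 3) 2 := ⟨fun p => ![![1, 3, 0] p, ![2, 4, 5] p], mk _ _ (by decide)⟩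
  let v : Schedule (Fin 3) 2 := ⟨fun p => ![![0, 1, 2] p, ![5, 4, 3] p], mk _ _ (by decide)⟩
  let l (u : Schedule (Fin 3) 2) (ω : Ω) (p : Fin 3) : ℕ :=
    splitLevel (F.time u ω p 0) (F.time u ω p 1)
  have key : ∀ p : Fin 3, p ≠ 2 → ∀ j : ℕ,
      μ.real {ω ∈ F.good w | l w ω p < j ∧ j ≤ l w ω 2} ≤ 2 * ε := by
    intro p hp2 j
    have h1 := F.close w v 2 {t | j ≤ splitLevel (t 0) (t 1)}
    have h2 := F.close v w p {t | j ≤ splitLevel (t 0) (t 1)}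
    have hlt0 : v.1 p 0 < v.1 2 0 := by fin_cases p <;> simp_all [v]
    have hlt1 : v.1 2 1 < v.1 p 1 := by fin_cases p <;> simp_all [v]
    have h3 : μ.real {ω ∈ F.good v | j ≤ l v ω 2} ≤ μ.real {ω ∈ F.good v | j ≤ l v ω p} :=
      measureReal_mono fun ω hω => ⟨hω.1, hω.2.trans
        (splitLevel_mono (F.ordered hω.1 hlt0) (F.ordered hω.1 hlt1))⟩
    have hw0 : w.1 2 0 < w.1 p 0 := by fin_cases p <;> simp_all [w]
    have hw1 : w.1 p 1 < w.1 2 1 := by fin_cases p <;> simp_all [w]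
    have h4 : {ω ∈ F.good w | j ≤ l w ω p} ⊆ {ω ∈ F.good w | j ≤ l w ω 2} :=
      fun ω hω => ⟨hω.1, hω.2.trans
        (splitLevel_mono (F.ordered hω.1 hw0) (F.ordered hω.1 hw1))⟩
    have h5 := measureReal_sdiff (μ := μ) h4 MeasurableSet.of_discrete
    have h6 : μ.real {ω ∈ F.good w | l w ω p < j ∧ j ≤ l w ω 2} ≤
        μ.real ({ω ∈ F.good w | j ≤ l w ω 2} \ {ω ∈ F.good w | j ≤ l w ω p}) :=
      measureReal_mono fun ω hω => ⟨⟨hω.1, hω.2.2⟩, fun h => absurd h.2 (not_le.2 hω.2.1)⟩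
    simp only [Set.mem_ofPred_eq] at h1 h2
    linarith
  have h0 := key 0 (by simp)
  have h1 := key 1 (by simp)
  have hcover : F.good w ⊆ ⋃ j : Fin m, ({ω ∈ F.good w | l w ω 0 < j ∧ j ≤ l w ω 2} ∪
      {ω ∈ F.good w | l w ω 1 < j ∧ j ≤ l w ω 2}) := by
    intro ω hω
    have hs : ∀ p, F.time w ω p 0 < F.time w ω p 1 := fun p => F.strictMono hω p (by simp)
    have hord : ∀ p q i j, w.1 p i < w.1 q j → F.time w ω p i ≤ F.time w ω q j :=
      fun p q i j => F.ordered hω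
    have b1 : l w ω 0 ≤ l w ω 2 :=
      splitLevel_mono (hord _ _ _ _ (by simp [w])) (hord _ _ _ _ (by simp [w]))
    have b2 : l w ω 1 ≤ l w ω 2 :=
      splitLevel_mono (hord _ _ _ _ (by simp [w])) (hord _ _ _ _ (by simp [w]))
    have b3 : l w ω 0 < l w ω 2 ∨ l w ω 1 < l w ω 2 := by
      by_cases he : l w ω 0 = l w ω 1
      · left
        refine (lt_splitLevel_of_eq (hs 0) (hord 0 1 1 0 (by simp [w])) (hs 1) he).trans_le ?_
        exact splitLevel_mono (hord _ _ _ _ (by simp [w])) (hord _ _ _ _ (by simp [w]))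
      · omega
    have b4 : l w ω 2 < m := splitLevel_lt (hs 2) (F.time_lt hω 2 1)
    refine Set.mem_iUnion.2 ⟨⟨l w ω 2, b4⟩, ?_⟩
    exact b3.imp (fun h => ⟨hω, h, le_rfl⟩) (fun h => ⟨hω, h, le_rfl⟩)
  calc c ≤ μ.real (F.good w) := F.mass w
    _ ≤ _ := measureReal_mono hcover
    _ ≤ _ := measureReal_iUnion_fintype_le _
    _ ≤ ∑ j : Fin m, 4 * ε := Finset.sum_le_sum fun j _ => by
        have := measureReal_union_le (μ := μ) {ω ∈ F.good w | l w ω 0 < j ∧ j ≤ l w ω 2}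
          {ω ∈ F.good w | l w ω 1 < j ∧ j ≤ l w ω 2}
        have := h0 j
        have := h1 j
        linarith
    _ = 4 * ε * m := by simp; ring

end TimeFamily

/-! ### Towers -/

/-- The tower of `s` twos with `m` on top. -/
def tower (s m : ℕ) : ℕ := (fun x => 2 ^ x)^[s] m

lemma tower_succ (s m : ℕ) : tower (s + 1) m = 2 ^ tower s m :=
  Function.iterate_succ_apply' _ _ _

/-- The letters used for a tower of height `s + 1`: three letters for the base case, and two helper
letters for each application of `TimeFamily.exists_log`. -/
def Letters : ℕ → Type
  | 0 => Fin 3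
  | s + 1 => Option (Option (Letters s))

instance instFintypeLetters : (s : ℕ) → Fintype (Letters s)
  | 0 => inferInstanceAs (Fintype (Fin 3))
  | s + 1 =>
    haveI := instFintypeLetters s
    inferInstanceAs (Fintype (Option (Option (Letters s))))

lemma card_letters (s : ℕ) : Fintype.card (Letters s) = 2 * s + 3 := by
  induction s with
  | zero => rfl
  | succ s ih =>
    change Fintype.card (Option (Option (Letters s))) = _
    rw [Fintype.card_option, Fintype.card_option, ih]
    ring

/-- A family with `s + 2` nodes per letter and times below a tower of `s + 1` twos with `m` on top has
`m` of order at least `1 / ε`. -/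
theorem exists_mass_le (s : ℕ) : ∃ K : ℝ, 0 ≤ K ∧ ∀ (Ω : Type) (_ : MeasurableSpace Ω)
    (_ : DiscreteMeasurableSpace Ω) (μ : Measure Ω) (_ : IsFiniteMeasure μ) (m : ℕ) (c ε : ℝ),
    1 ≤ m → 0 ≤ ε → TimeFamily μ (Letters s) (s + 2) (tower (s + 1) m) c ε → c ≤ K * ε * m := by
  induction s with
  | zero =>
    exact ⟨4, by norm_num, fun Ω _ _ μ _ m c ε _ _ F => F.mass_le_of_two_nodes⟩
  | succ s ih =>
    obtain ⟨K, hK, h⟩ := ih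
    set R : ℝ := 2 * (Fintype.card (Letters s) * (s + 2) ^ 2 + 1) with hR
    have hR0 : 0 ≤ R := by positivity
    refine ⟨2 * (K * (1 + R)) + 8 + 2 * R, by positivity, ?_⟩
    intro Ω _ _ μ _ m c ε hm hε F
    rw [tower_succ] at F
    obtain ⟨F'⟩ := TimeFamily.exists_log (A := Letters s) hε F
    have h1 := h Ω _ ‹_› μ ‹_› m _ _ hm (by positivity) F'
    rw [← hR] at h1
    have hm' : (1 : ℝ) ≤ m := by exact_mod_cast hm
    have h2 : (8 + 2 * R) * ε * 1 ≤ (8 + 2 * R) * ε * m := by gcongr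
    nlinarith

/-! ### The game -/

section Game

variable (P : Type) [Fintype P] (k : ℕ)

/-- An order of moves: the positions of the `k` nodes of each player on a path of all the players'
nodes, where `(p, i)` is the node number `i` of `p`. -/
abbrev MoveOrder : Type :=
  {σ : P × Fin k ≃ Fin (Fintype.card P * k) // ∀ p, StrictMono fun i => σ (p, i)}

/-- Chance chooses an order of moves `σ` at the root (the action `some σ`). Then follows a path, on
which the only action available is `none`. -/
def orderTree : GameTree (Option (MoveOrder P k)) where
  histories := {h | h = [] ∨ ∃ (σ : MoveOrder P k) (j : ℕ), j ≤ Fintype.card P * k ∧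
    h = some σ :: List.replicate j none}
  finite_histories := by
    classical
    refine ((Set.finite_singleton []).union (Set.finite_range
      fun x : MoveOrder P k × Fin (Fintype.card P * k + 1) =>
        some x.1 :: List.replicate (x.2 : ℕ) none)).subset ?_
    rintro h (rfl | ⟨σ, j, hj, rfl⟩)
    · exact Or.inl rfl
    · exact Or.inr ⟨(σ, ⟨j, Nat.lt_succ_of_le hj⟩), rfl⟩
  nil_mem := Or.inl rfl
  prefix_mem := by
    rintro (_ | ⟨b, h⟩) a hh
    · exact Or.inl rfl
    · obtain hh | ⟨σ, j, hj, hh⟩ := hh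
      · simp at hh
      · rw [List.cons_append, List.cons.injEq] at hh
        obtain ⟨rfl, hh⟩ := hh
        have hlen := congrArg List.length hh
        simp only [List.length_append, List.length_replicate, List.length_singleton] at hlen
        refine Or.inr ⟨σ, h.length, by omega, ?_⟩
        rw [List.cons.injEq]
        refine ⟨rfl, List.eq_replicate_iff.2 ⟨rfl, fun b hb => ?_⟩⟩
        exact List.eq_of_mem_replicate (hh ▸ List.mem_append_left [a] hb)

variable {P k}

/-- The node number `j` of the path of `σ`; the last one, `j = card P * k`, is a leaf. -/
def orderNode (σ : MoveOrder P k) (j : ℕ) (hj : j ≤ Fintype.card P * k) :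
    (orderTree P k).Node :=
  ⟨some σ :: List.replicate j none, Or.inr ⟨σ, j, hj, rfl⟩⟩

lemma eq_nil_or_eq_orderNode (v : (orderTree P k).Node) :
    v.1 = [] ∨ ∃ σ j hj, v = orderNode σ j hj := by
  obtain ⟨h, rfl | ⟨σ, j, hj, rfl⟩⟩ := v
  · exact Or.inl rfl
  · exact Or.inr ⟨σ, j, hj, rfl⟩

lemma available_orderNode {σ : MoveOrder P k} {j : ℕ} (hj : j ≤ Fintype.card P * k)
    (a : Option (MoveOrder P k)) :
    (orderTree P k).Available (orderNode σ j hj) a ↔ a = none ∧ j < Fintype.card P * k := by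
  constructor
  · rintro (h | ⟨τ, i, hi, h⟩)
    · simp [orderNode] at h
    · simp only [orderNode, List.cons_append, List.cons.injEq] at h
      have hlen := congrArg List.length h.2
      simp only [List.length_append, List.length_replicate, List.length_singleton] at hlen
      exact ⟨List.eq_of_mem_replicate (h.2 ▸ List.mem_append_right _ (List.mem_singleton.2 rfl)),
        by omega⟩
  · rintro ⟨rfl, h⟩
    refine Or.inr ⟨σ, j + 1, h, ?_⟩
    simp [orderNode, List.replicate_succ']

lemma isTerminal_orderNode {σ : MoveOrder P k} {j : ℕ} (hj : j ≤ Fintype.card P * k) :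
    (orderTree P k).IsTerminal (orderNode σ j hj) ↔ j = Fintype.card P * k := by
  simp only [GameTree.IsTerminal, available_orderNode, not_and]
  constructor
  · intro h
    have := h none rfl
    omega
  · rintro rfl a _
    exact lt_irrefl _

/-- The player who moves after a history, with the number of her earlier nodes; `none` at the root
and at the leaves. -/
noncomputable def owner : List (Option (MoveOrder P k)) → Option (P × Fin k)
  | some σ :: l =>
    if h : l.length < Fintype.card P * k then some (σ.1.symm ⟨l.length, h⟩) else none
  | _ => none

lemma owner_orderNode (σ : MoveOrder P k) (x : P × Fin k) :
    owner (orderNode σ (σ.1 x) (σ.1 x).2.le).1 = some x := by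
  simp [owner, orderNode]

variable (P k) in
/-- The game in which Chance chooses the order of the moves of all players, and a player only knows
how often she has moved before. -/
noncomputable abbrev orderGame : ExtensiveFormGame P where
  Action := Option (MoveOrder P k)
  tree := orderTree P k
  mover v := (owner v.1).map Prod.fst
  Info := Option (Fin k)
  info v := (owner v.1).map Prod.snd
  available_iff p v w hv hw hpv hpw _ a := by
    have key : ∀ u : (orderTree P k).Node, ¬ (orderTree P k).IsTerminal u →
        (owner u.1).map Prod.fst = some p → ((orderTree P k).Available u a ↔ a = none) := by
      intro u hu hpu
      rcases eq_nil_or_eq_orderNode u with h | ⟨σ, j, hj, rfl⟩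
      · rw [h] at hpu
        simp [owner] at hpu
      · rw [isTerminal_orderNode] at hu
        rw [available_orderNode]
        exact ⟨fun h => h.1, fun h => ⟨h, lt_of_le_of_ne hj hu⟩⟩
    rw [key v hv hpv, key w hw hpw]
  chance v hv _ := by
    classical
    exact PMF.uniformOfFinset (Finset.univ.filter ((orderTree P k).Available v)) (by
      simpa [GameTree.IsTerminal, Finset.filter_nonempty_iff] using hv)
  chance_support v hv hc a := by
    classical
    simp
  payoff _ _ := 0

lemma belongs_iff {p : P} {v : (orderGame P k).Node} :
    (orderGame P k).Belongs p v ↔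
      ∃ (σ : MoveOrder P k) (i : Fin k), v = orderNode σ (σ.1 (p, i)) (σ.1 (p, i)).2.le := by
  constructor
  · rintro ⟨hv, hm⟩
    rcases eq_nil_or_eq_orderNode v with h | ⟨σ, j, hj, rfl⟩
    · simp [owner, h] at hm
    · have hj' : j < Fintype.card P * k :=
        lt_of_le_of_ne hj fun h => hv ((isTerminal_orderNode hj).2 h)
      obtain ⟨⟨q, i⟩, hx⟩ := σ.1.surjective ⟨j, hj'⟩
      have hjx : j = σ.1 (q, i) := by rw [hx]
      subst hjx
      have hm' : (owner (orderNode σ (σ.1 (q, i)) hj).1).map Prod.fst = some p := hm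
      rw [owner_orderNode] at hm'
      obtain rfl : q = p := by simpa using hm'
      exact ⟨σ, i, rfl⟩
  · rintro ⟨σ, i, rfl⟩
    refine ⟨fun h => (σ.1 (p, i)).2.ne ((isTerminal_orderNode _).1 h), ?_⟩
    change (owner (orderNode σ (σ.1 (p, i)) _).1).map Prod.fst = some p
    rw [owner_orderNode]
    rfl

lemma info_orderNode (σ : MoveOrder P k) (x : P × Fin k) :
    (orderGame P k).info (orderNode σ (σ.1 x) (σ.1 x).2.le) = some x.2 := by
  change (owner (orderNode σ (σ.1 x) _).1).map Prod.snd = some x.2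
  rw [owner_orderNode]
  rfl

end Game

/-! ### The nodes of a player on a path -/

lemma mem_ownNodes {P : Type} (Γ : ExtensiveFormGame P) {p : P} {v g : Γ.Node} :
    g ∈ Γ.ownNodes p v ↔ g.1 <+: v.1 ∧ Γ.Belongs p g := by
  classical
  simp only [ExtensiveFormGame.ownNodes, List.mem_filterMap, List.mem_inits]
  constructor
  · rintro ⟨h, hh, he⟩
    split_ifs at he with hg
    · obtain rfl := Option.some_injective _ he
      exact ⟨hh, hg.2⟩
  · rintro ⟨hh, hb⟩
    exact ⟨g.1, hh, by rw [dif_pos ⟨g.2, hb⟩]⟩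

lemma pairwise_length_inits {α : Type} (l : List α) :
    l.inits.Pairwise fun a b => a.length < b.length := by
  induction l with
  | nil => simp
  | cons a l ih =>
    rw [List.inits_cons, List.pairwise_cons]
    refine ⟨by simp, ?_⟩
    rw [List.pairwise_map]
    exact ih.imp fun h => by simpa using h

lemma pairwise_ownNodes {P : Type} (Γ : ExtensiveFormGame P) (p : P) (v : Γ.Node) :
    (Γ.ownNodes p v).Pairwise fun a b => a.1.length < b.1.length := by
  classical
  refine List.Pairwise.filterMap _ (fun a b hab c hc d hd => ?_) (pairwise_length_inits v.1)
  split_ifs at hc hd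
  · obtain rfl := Option.some_injective _ hc
    obtain rfl := Option.some_injective _ hd
    exact hab

section Game
variable {P : Type} [Fintype P] {k : ℕ}

lemma ownNodes_orderNode (p : P) (σ : MoveOrder P k) (j : ℕ) (hj : j ≤ Fintype.card P * k) :
    (orderGame P k).ownNodes p (orderNode σ j hj) =
      ((List.finRange k).filter fun i => (σ.1 (p, i) : ℕ) ≤ j).map
        fun i => orderNode σ (σ.1 (p, i)) (σ.1 (p, i)).2.le := by
  have : Std.Irrefl fun a b : (orderGame P k).Node => a.1.length < b.1.length :=
    ⟨fun a => lt_irrefl _⟩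
  have : Std.Asymm fun a b : (orderGame P k).Node => a.1.length < b.1.length :=
    ⟨fun a b h => lt_asymm h⟩
  refine List.Pairwise.eq_of_mem_iff (r := fun a b : (orderGame P k).Node =>
    a.1.length < b.1.length) (pairwise_ownNodes _ _ _) ?_ fun g => ?_
  · rw [List.pairwise_map]
    refine ((List.pairwise_lt_finRange k).filter _).imp fun {a b} hab => ?_
    have : (σ.1 (p, a) : ℕ) < σ.1 (p, b) := σ.2 p hab
    simpa [orderNode] using this
  · rw [mem_ownNodes, belongs_iff, List.mem_map]
    constructor
    · rintro ⟨hpre, τ, i, rfl⟩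
      have hpre' : (some τ :: List.replicate (τ.1 (p, i) : ℕ) none) <+:
        (some σ :: List.replicate j none) := hpre
      rw [List.cons_prefix_cons] at hpre'
      obtain ⟨h1, h2⟩ := hpre'
      obtain rfl := Option.some_injective _ h1
      exact ⟨i, by simpa using h2.length_le, rfl⟩
    · rintro ⟨i, hi, rfl⟩
      refine ⟨?_, σ, i, rfl⟩
      change (some σ :: List.replicate (σ.1 (p, i) : ℕ) none) <+:
        (some σ :: List.replicate j none)
      rw [List.cons_prefix_cons]
      have hi' : (σ.1 (p, i) : ℕ) ≤ j := by simpa using hi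
      exact ⟨rfl, List.replicate (j - σ.1 (p, i)) none, by
        rw [List.replicate_append_replicate, Nat.add_sub_cancel' hi']⟩

lemma length_ownNodes_le (p : P) (v : (orderGame P k).Node) :
    ((orderGame P k).ownNodes p v).length ≤ k := by
  rcases eq_nil_or_eq_orderNode v with h | ⟨σ, j, hj, rfl⟩
  · suffices (orderGame P k).ownNodes p v = [] by simp [this]
    refine List.eq_nil_iff_forall_not_mem.2 fun g hg => ?_
    rw [mem_ownNodes, belongs_iff] at hg
    obtain ⟨hpre, σ, i, rfl⟩ := hg
    have h' : v.1 = [] := h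
    rw [h', List.prefix_nil] at hpre
    simp [orderNode] at hpre
  · rw [ownNodes_orderNode, List.length_map]
    exact (List.length_filter_le _ _).trans (by simp)

lemma perfectRecall_orderGame : (orderGame P k).PerfectRecall := by
  rintro p v w ⟨hv, hw, hinfo⟩
  obtain ⟨σ, i, rfl⟩ := belongs_iff.1 hv
  obtain ⟨τ, i', rfl⟩ := belongs_iff.1 hw
  rw [info_orderNode, info_orderNode] at hinfo
  obtain rfl : i = i' := Option.some_injective _ hinfo
  have key : ∀ ρ : MoveOrder P k,
      (orderGame P k).experience p (orderNode ρ (ρ.1 (p, i)) (ρ.1 (p, i)).2.le) =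
        ((List.finRange k).filter fun l => l ≤ i).map
          fun l => (some l, if l < i then some none else none) := by
    intro ρ
    rw [ExtensiveFormGame.experience, ownNodes_orderNode, List.map_map]
    have hfil : ((List.finRange k).filter fun l => (ρ.1 (p, l) : ℕ) ≤ ρ.1 (p, i)) =
        (List.finRange k).filter fun l => l ≤ i := by
      refine List.filter_congr fun l _ => ?_
      have : ρ.1 (p, l) ≤ ρ.1 (p, i) ↔ l ≤ i := (ρ.2 p).le_iff_le
      simpa using this
    rw [hfil]
    refine List.map_congr_left fun l _ => ?_
    refine Prod.ext (info_orderNode ρ (p, l)) ?_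
    have hlt : (ρ.1 (p, l) : ℕ) < ρ.1 (p, i) ↔ l < i := (ρ.2 p).lt_iff_lt
    change (some ρ :: List.replicate (ρ.1 (p, i) : ℕ) none)[
      (some ρ :: List.replicate (ρ.1 (p, l) : ℕ) none).length]? = _
    simp only [List.length_cons, List.length_replicate, List.getElem?_cons_succ,
      List.getElem?_replicate, hlt]
  rw [key, key]

/-! ### Timings of the game -/

/-- Every schedule is realized by one of the orders that Chance can choose. -/
lemma exists_moveOrder (w : Schedule P k) :
    ∃ σ : MoveOrder P k, ∀ p q i j, w.1 p i < w.1 q j → σ.1 (p, i) < σ.1 (q, j) := by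
  have hcard : Fintype.card (P × Fin k) = Fintype.card P * k := by simp
  let e : P × Fin k ≃ Fin (Fintype.card P * k) := Fintype.equivFinOfCardEq hcard
  let f : Fin (Fintype.card P * k) → ℤ := fun x => w.1 (e.symm x).1 (e.symm x).2
  have hmono := Tuple.monotone_sort f
  have key : ∀ p q i j, w.1 p i < w.1 q j →
      (e.trans (Tuple.sort f).symm) (p, i) < (e.trans (Tuple.sort f).symm) (q, j) := by
    intro p q i j h
    refine hmono.reflect_lt ?_
    simpa [f] using h
  exact ⟨⟨e.trans (Tuple.sort f).symm, fun p i j hij => key p p i j (w.2 p hij)⟩, key⟩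

lemma timing_add_one_le (t : (orderGame P k).DetTiming) (σ : MoveOrder P k) {i j : ℕ}
    (hij : i < j) (hj : j ≤ Fintype.card P * k) :
    t.1 (orderNode σ i (hij.le.trans hj)) + 1 ≤ t.1 (orderNode σ j hj) := by
  have step : ∀ i (hi : i + 1 ≤ Fintype.card P * k),
      t.1 (orderNode σ i (Nat.le_of_succ_le hi)) + 1 ≤ t.1 (orderNode σ (i + 1) hi) :=
    fun i hi => t.2.2 _ _ ⟨none, by simp only [orderNode, List.replicate_succ', List.cons_append]⟩
  induction j, hij using Nat.le_induction with
  | base => exact step i hj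
  | succ j hij ih =>
    have h1 := ih (Nat.le_of_succ_le hj)
    have h2 := step j hj
    linarith

end Game

lemma measureReal_preimage_le_of_tvDist_le {α β : Type} [MeasurableSpace α]
    [DiscreteMeasurableSpace α] (X : PMF α) (f g : α → β) {ε : ℝ} (hε : 0 ≤ ε)
    (h : tvDist (X.map f) (X.map g) ≤ ENNReal.ofReal ε) (S : Set β) :
    X.toMeasure.real (f ⁻¹' S) ≤ X.toMeasure.real (g ⁻¹' S) + ε := by
  have key : (X.map f).toOuterMeasure S ≤ (X.map g).toOuterMeasure S + ENNReal.ofReal ε := by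
    refine le_trans ?_ (add_le_add_right h _)
    rw [PMF.toOuterMeasure_apply, PMF.toOuterMeasure_apply, tvDist, ← ENNReal.tsum_add]
    refine ENNReal.tsum_le_tsum fun x => ?_
    by_cases hx : x ∈ S
    · simp only [Set.indicator_of_mem hx]
      exact le_add_tsub
    · simp [Set.indicator_of_notMem hx]
  rw [PMF.toOuterMeasure_map_apply, PMF.toOuterMeasure_map_apply,
    ← PMF.toMeasure_apply_eq_toOuterMeasure, ← PMF.toMeasure_apply_eq_toOuterMeasure] at key
  have h2 := ENNReal.toReal_mono (by finiteness) key
  rwa [ENNReal.toReal_add (by finiteness) (by finiteness), ENNReal.toReal_ofReal hε] at h2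

/-- The integer parts of the times in an `ε`-timing of the game form a family. At her last node on a
path, the timing information of a player consists of the times of all her nodes. -/
theorem exists_timeFamily {P : Type} [Fintype P] {k N : ℕ} {ε : ℝ} (hε : 0 ≤ ε)
    (X : (orderGame P k).Timing) [MeasurableSpace (orderGame P k).DetTiming]
    [DiscreteMeasurableSpace (orderGame P k).DetTiming] (hX : (orderGame P k).IsEpsTiming ε X)
    (hN : ∀ t ∈ X.support, ∀ v, t.1 v < N) :
    Nonempty (TimeFamily X.toMeasure P k N 1 ε) := by
  choose σ hσ using exists_moveOrder (P := P) (k := k)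
  let node (w : Schedule P k) (p : P) (i : Fin k) : (orderGame P k).Node :=
    orderNode (σ w) ((σ w).1 (p, i)) ((σ w).1 (p, i)).2.le
  have hstep : ∀ (t : (orderGame P k).DetTiming) w p q i j, (σ w).1 (p, i) < (σ w).1 (q, j) →
      t.1 (node w p i) + 1 ≤ t.1 (node w q j) := fun t w p q i j h =>
    timing_add_one_le t (σ w) (Fin.lt_def.1 h) _
  refine ⟨{
    good := fun _ => X.support
    time := fun w t p i => ⌊t.1 (node w p i)⌋₊
    ordered := fun {w t p q i j} _ h =>
      Nat.floor_mono (by linarith [hstep t w p q i j (hσ w p q i j h)])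
    strictMono := fun {w t} _ p i j hij => by
      have h1 := hstep t w p p i j ((σ w).2 p hij)
      have h2 := Nat.floor_mono h1
      rw [Nat.floor_add_one (t.2.1 _)] at h2
      exact h2
    time_lt := fun {w t} ht p i => (Nat.floor_lt (t.2.1 _)).2 (hN t ht _)
    close := fun w v p S => ?_
    mass := fun w => ?_ }⟩
  · rcases Nat.eq_zero_or_pos k with rfl | hk
    · have : ∀ u : Schedule P 0, {t ∈ X.support |
          (fun i => ⌊t.1 (node u p i)⌋₊) ∈ S} = {t ∈ X.support | Fin.elim0 ∈ S} := by
        intro u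
        ext t
        simp [Subsingleton.elim (fun i => ⌊t.1 (node u p i)⌋₊) Fin.elim0]
      rw [this, this]
      linarith
    · let last : Fin k := ⟨k - 1, by omega⟩
      have hlast : ∀ i : Fin k, i ≤ last := fun i => Fin.le_def.2 (by simp [last]; omega)
      have hsame : (orderGame P k).SameInfoSet p (node w p last) (node v p last) :=
        ⟨belongs_iff.2 ⟨_, _, rfl⟩, belongs_iff.2 ⟨_, _, rfl⟩, by
          rw [info_orderNode, info_orderNode]⟩
      have htime : ∀ (u : Schedule P k) (t : (orderGame P k).DetTiming),
          (orderGame P k).timingInfo p (node u p last) t =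
            List.ofFn fun i => t.1 (node u p i) := by
        intro u t
        have hall : ((List.finRange k).filter
            fun i => ((σ u).1 (p, i) : ℕ) ≤ (σ u).1 (p, last)) = List.finRange k := by
          refine List.filter_eq_self.2 fun i _ => ?_
          simpa using ((σ u).2 p).monotone (hlast i)
        rw [ExtensiveFormGame.timingInfo, ownNodes_orderNode, hall, List.map_map,
          List.ofFn_eq_map]
        rfl
      have h := measureReal_preimage_le_of_tvDist_le X _ _ hε (hX p _ _ hsame)
        {l | (fun i : Fin k => ⌊l.getD i 0⌋₊) ∈ S}
      have hset : ∀ u : Schedule P k, X.toMeasure.real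
          ((orderGame P k).timingInfo p (node u p last) ⁻¹'
            {l | (fun i : Fin k => ⌊l.getD i 0⌋₊) ∈ S}) =
          X.toMeasure.real {t ∈ X.support | (fun i => ⌊t.1 (node u p i)⌋₊) ∈ S} := by
        intro u
        rw [measureReal_def, measureReal_def, ← PMF.toMeasure_apply_inter_support _ .of_discrete]
        congr 2
        ext t
        simp [htime, and_comm]
      rw [hset, hset] at h
      exact h
  · rw [measureReal_def, (PMF.toMeasure_apply_eq_one_iff _ .of_discrete).2 subset_rfl]
    simp

lemma expTwoIter_le_tower (s m : ℕ) {x : ℝ} (hx : x ≤ 2 ^ m) :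
    expTwoIter s x ≤ tower (s + 1) m := by
  induction s with
  | zero => simpa [expTwoIter, tower] using hx
  | succ s ih =>
    rw [tower_succ, expTwoIter, Function.iterate_succ_apply']
    push_cast
    rw [← Real.rpow_natCast]
    exact Real.rpow_le_rpow_of_exponent_le (by norm_num) ih

/-- For small `ε`, the least `m` with `1 / ε ≤ 2 ^ m` is small compared to `1 / ε`. -/
lemma exists_exponent (K : ℝ) : ∃ ε₀ : ℝ, 0 < ε₀ ∧ ∀ ε : ℝ, 0 < ε → ε ≤ ε₀ →
    ∃ m : ℕ, 1 ≤ m ∧ 1 / ε ≤ 2 ^ m ∧ K * ε * m < 1 := by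
  have hlim := tendsto_pow_const_div_const_pow_of_one_lt 1 (one_lt_two (α := ℝ))
  have hpos : (0 : ℝ) < 1 / (2 * (|K| + 1)) := by positivity
  obtain ⟨M, hM⟩ := Filter.eventually_atTop.1 (hlim.eventually_lt_const hpos)
  refine ⟨1 / 2 ^ (M + 1), by positivity, fun ε hε hle => ?_⟩
  have hle' : (2 : ℝ) ^ (M + 1) ≤ 1 / ε := by
    rwa [le_one_div (by positivity) hε]
  have hex : ∃ m : ℕ, 1 / ε ≤ (2 : ℝ) ^ m :=
    (pow_unbounded_of_one_lt (1 / ε) one_lt_two).imp fun _ h => h.le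
  classical
  obtain ⟨m, hm⟩ : ∃ m, Nat.find hex = m := ⟨_, rfl⟩
  have hm1 : 1 / ε ≤ (2 : ℝ) ^ m := hm ▸ Nat.find_spec hex
  have hMm : M + 1 ≤ m := (pow_le_pow_iff_right₀ (one_lt_two (α := ℝ))).1 (hle'.trans hm1)
  obtain ⟨l, rfl⟩ : ∃ l, m = l + 1 := ⟨m - 1, by omega⟩
  have hm2 : (2 : ℝ) ^ l < 1 / ε := not_le.1 (Nat.find_min hex (by omega : l < Nat.find hex))
  refine ⟨l + 1, by omega, hm1, ?_⟩
  have h1 := hM (l + 1) (by omega)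
  rw [pow_one, div_lt_div_iff₀ (by positivity) (by positivity), pow_succ] at h1
  have h2 : ε * 2 ^ l < 1 := by rwa [lt_div_iff₀ hε, mul_comm] at hm2
  have h3 : (|K| + 1) * ((l + 1 : ℕ) : ℝ) < 2 ^ l := by linarith
  have h4 : K * ((l + 1 : ℕ) : ℝ) ≤ (|K| + 1) * ((l + 1 : ℕ) : ℝ) := by
    gcongr
    linarith [le_abs_self K]
  calc K * ε * ((l + 1 : ℕ) : ℝ) = ε * (K * ((l + 1 : ℕ) : ℝ)) := by ring
    _ ≤ ε * 2 ^ l := by gcongr; linarith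
    _ < 1 := h2

end TimingBound

open TimingBound in
theorem mainTheorem1 (r : ℕ) (hr : 1 ≤ r) :
    ∃ Γ : ExtensiveFormGame (Fin (16 * r + 3)),
      Γ.PerfectRecall ∧
      (∀ (p : Fin (16 * r + 3)) (v : Γ.Node), (Γ.ownNodes p v).length ≤ 3 * r) ∧
      ∃ ε₀ : ℝ, 0 < ε₀ ∧
        ∀ ε : ℝ, 0 < ε → ε ≤ ε₀ →
          ∀ X : Γ.Timing, Γ.IsEpsTiming ε X → Γ.UsesTimeAtLeast X (expTwoIter r (1 / ε)) := by
  obtain ⟨K, -, hK⟩ := exists_mass_le r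
  obtain ⟨ε₀, hε₀, hm⟩ := exists_exponent K
  refine ⟨orderGame (Fin (16 * r + 3)) (r + 2), perfectRecall_orderGame,
    fun p v => (length_ownNodes_le p v).trans (by omega), ε₀, hε₀, fun ε hε hle X hX => ?_⟩
  obtain ⟨m, hm1, hm2, hm3⟩ := hm ε hε hle
  by_contra hcon
  simp only [ExtensiveFormGame.UsesTimeAtLeast, not_exists, not_and, not_le] at hcon
  let _ : MeasurableSpace (orderGame (Fin (16 * r + 3)) (r + 2)).DetTiming := ⊤
  have : DiscreteMeasurableSpace (orderGame (Fin (16 * r + 3)) (r + 2)).DetTiming :=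
    ⟨fun _ => trivial⟩
  obtain ⟨F⟩ := exists_timeFamily (N := tower (r + 1) m) hε.le X hX
    fun t ht v => (hcon t ht v).trans_le (expTwoIter_le_tower r m hm2)
  obtain ⟨f⟩ := Function.Embedding.nonempty_of_card_le
    (α := Letters r) (β := Fin (16 * r + 3)) (by rw [card_letters, Fintype.card_fin]; omega)
  have h := hK _ _ inferInstance _ inferInstance m 1 ε hm1 hε.le (F.comap f f.injective)
  linarith
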